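/- Let $k>2$ and $m$ be positive integers with $m\ge\varphi(k)+1$, where $\varphi$ is Euler's totient function. Let $\zeta_k\in\mathbb{C}$ be any primitive $k$-th root of unity, let $\Phi_k$ be the $k$-th cyclotomic polynomial, and put $\beta=-m+\zeta_k$ and $\mathcal{N}=\{0,1,\ldots,|\Phi_k(m)|-1\}$. Then $(\beta,\mathcal{N})$ is a canonical number system in $\mathbb{Z}[\zeta_k]$. That is: (i) $\mathbb{Z}[\beta]=\mathbb{Z}[\zeta_k]$; (ii) if $P\in\mathbb{Z}[X]$ denotes the minimal polynomial of $\beta$ (a monic polynomial), then $|P(0)|=|\Phi_k(m)|$, so that $\mathcal{N}=\{0,1,\ldots,|P(0)|-1\}$, and every element of $\mathbb{Z}[X]/(P)$ has a unique representation $\sum_{j\ge0}a_jX^j$ with $a_j\in\mathcal{N}$ and only finitely many $a_j$ nonzero; (iii) correspondingly, every $\gamma\in\mathbb{Z}[\zeta_k]$ has a unique representation $\gamma=\sum_{j\ge0}a_j\beta^j$ with $a_j\in\mathcal{N}$ and only finitely many $a_j$ nonzero. -/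

import Mathlib

open Polynomial

/-- `(β, N)` is a number system in the commutative ring `R`: every element `γ` of `R` has a unique
finite representation `γ = ∑ j, a j * β ^ j` with all digits `a j` in `N`. (A representation is a
finitely supported sequence of digits, so leading zeros are not distinguished.) -/
def IsNumberSystem {R : Type*} [CommRing R] (β : R) (N : Set ℤ) : Prop :=
  ∀ γ : R, ∃! a : ℕ →₀ ℤ, (∀ j, a j ∈ N) ∧ γ = a.sum fun j d => (d : R) * β ^ j

/-- `(P, N)` is a canonical number system: `P` is a monic integer polynomial with constant
coefficient `p₀`, `N = {0, 1, …, |p₀| - 1}`, and every element of `ℤ[X] / (P)` has a unique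
representation in powers of (the class of) `X` with digits in `N`. -/
structure IsCanonicalNumberSystem (P : ℤ[X]) (N : Set ℤ) : Prop where
  monic : P.Monic
  digits : N = Set.Ico 0 |P.coeff 0|
  isNumberSystem : IsNumberSystem (AdjoinRoot.root P) N

/-- `(β, N)` is a canonical number system in the subring `R = ℤ[β]` of `ℂ`: `(P, N)` is a canonical
number system for the minimal polynomial `P` of `β` over `ℤ`, and, correspondingly, every element of
`R` has a unique representation in powers of `β` with digits in `N`. -/
structure IsCanonicalNumberSystemIn (β : ℂ) (N : Set ℤ) (R : Subalgebra ℤ ℂ) : Prop where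
  adjoin_eq : Algebra.adjoin ℤ {β} = R
  minpoly_isCanonical : IsCanonicalNumberSystem (minpoly ℤ β) N
  existsUnique_repr : ∀ γ ∈ R, ∃! a : ℕ →₀ ℤ,
    (∀ j, a j ∈ N) ∧ γ = a.sum fun j d => (d : ℂ) * β ^ j

/-! The minimal polynomial of `-m + ζ` is `P = Φ_k(X + m)`, with coefficients `p_n = Φ_k^(n)(m) /
n!`. By Gauss–Lucas every nonconstant derivative of `Φ_k` has its roots in the closed unit disc, so
its logarithmic derivative at `m`, a sum of at most `φ(k)` terms `1 / (m - z)`, lies in `(0, 1]`.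
Hence `(n + 1) p_{n+1} ≤ p_n`, and the `p_n` decrease (`antitone_coeff_taylor`). Kovács' criterion
(`isNumberSystem_of_antitone_coeff`) then applies: `(1 - X) P` vanishes at the base and yields `p_0
= β D(β)` with `D` nonnegative of coefficient sum `p_0`, so carries preserve the digit sum. -/

/-- Digit sequences may be taken to be the coefficient sequences of integer polynomials. -/
theorem isNumberSystem_of_existsUnique_polynomial {R : Type*} [CommRing R] {β : R} {N : Set ℤ}
    (h : ∀ γ : R, ∃! p : ℤ[X], (∀ j, p.coeff j ∈ N) ∧ γ = aeval β p) :
    IsNumberSystem β N := by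
  have key : ∀ a : ℕ →₀ ℤ, ∃ p : ℤ[X], (∀ j, p.coeff j = a j) ∧
      aeval β p = a.sum fun j d => (d : R) * β ^ j := by
    intro a
    refine ⟨a.sum fun j d => monomial j d, fun j => ?_, ?_⟩
    · simp only [Finsupp.sum, finsetSum_coeff, coeff_monomial]
      simp +contextual [eq_comm]
    · simp [Finsupp.sum, aeval_monomial]
  intro γ
  obtain ⟨p, ⟨hpN, hp⟩, huniq⟩ := h γ
  refine ⟨Finsupp.onFinset p.support p.coeff fun j hj => mem_support_iff.2 hj, ⟨hpN, ?_⟩, ?_⟩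
  · obtain ⟨q, hq, hqs⟩ := key (Finsupp.onFinset p.support p.coeff fun j hj => mem_support_iff.2 hj)
    have : q = p := by ext j; simp [hq]
    rw [← hqs, this, hp]
  · rintro a ⟨haN, ha⟩
    obtain ⟨q, hq, hqs⟩ := key a
    have : q = p := huniq q ⟨fun j => by rw [hq]; exact haN j, by rw [hqs, ha]⟩
    ext j
    simp [← hq, this]

/-! ### Kovács' criterion -/

/-- Uniqueness of digits, with `e` the difference of two expansions: modulo `β` only the constant
term survives, so `b` divides it and it vanishes; then cancel `β` and shift. -/
theorem eq_zero_of_aeval_eq_zero_of_abs_coeff_lt {R : Type*} [CommRing R] [IsDomain R] {β : R}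
    (hβ : β ≠ 0) {b : ℤ} (hdvd : ∀ n : ℤ, β ∣ (n : R) → b ∣ n) {e : ℤ[X]}
    (he : ∀ j, |e.coeff j| < b) (h0 : aeval β e = 0) : e = 0 := by
  ext n
  rw [coeff_zero]
  induction n generalizing e with
  | zero =>
    refine Int.eq_zero_of_abs_lt_dvd (hdvd _ ⟨-aeval β e.divX, ?_⟩) (he 0)
    rw [← X_mul_divX_add e] at h0
    simp only [map_add, map_mul, aeval_X, eq_intCast, map_intCast] at h0
    linear_combination h0
  | succ n ih =>
    have hz : e.coeff 0 = 0 := by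
      refine Int.eq_zero_of_abs_lt_dvd (hdvd _ ⟨-aeval β e.divX, ?_⟩) (he 0)
      rw [← X_mul_divX_add e] at h0
      simp only [map_add, map_mul, aeval_X, eq_intCast, map_intCast] at h0
      linear_combination h0
    rw [← coeff_divX]
    refine ih (fun j => by rw [coeff_divX]; exact he _) ?_
    rw [← X_mul_divX_add e, hz] at h0
    simpa [hβ] using h0

/-- Existence of digit expansions for values of polynomials with natural coefficients: replacing
`b` by `β * D(β)`, where the coefficients of `D` sum up to `b`, never increases the digit sum. -/
theorem exists_digits_of_aeval_nat {R : Type*} [CommRing R] {β : R} {b : ℕ} (hb : 0 < b)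
    {D : ℕ[X]} (hD : D.eval 1 = b) (hDβ : β * aeval β D = b)
    (hmul : ∀ γ : R, γ ≠ 0 → FiniteMultiplicity β γ) (A : ℕ[X]) :
    ∃ p : ℤ[X], (∀ j, p.coeff j ∈ Set.Ico 0 (b : ℤ)) ∧ aeval β A = aeval β p := by
  induction hs : A.eval 1 using Nat.strong_induction_on generalizing A with
  | _ s ihs =>
  by_cases hA : aeval β A = 0
  · exact ⟨0, by simp [hb], by simp [hA]⟩
  obtain ⟨n, hn⟩ := hmul _ hA
  -- Inner induction on `t` with `β ^ t` not dividing the value: a digit `r = 0` keeps the digit sum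
  -- but lowers `t`, while `r > 0` lowers the digit sum.
  generalize hn' : n + 1 = t at hn
  clear hn' n
  induction t generalizing A with
  | zero => simp at hn
  | succ t iht =>
    set r := A.coeff 0 % b with hr
    set q := A.coeff 0 / b with hq
    have hrq : r + b * q = A.coeff 0 := Nat.mod_add_div _ _
    set A' : ℕ[X] := A.divX + C q * D with hA'
    have heval : A.eval 1 = A'.eval 1 + r := by
      conv_lhs => rw [← X_mul_divX_add A]
      simp only [hA', eval_add, eval_mul, eval_X, eval_C, hD, one_mul]
      linarith
    have haeval : aeval β A = r + β * aeval β A' := by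
      conv_lhs => rw [← X_mul_divX_add A]
      simp only [hA', map_add, map_mul, aeval_X, eq_natCast, map_natCast, ← hrq, ← hDβ]
      ring
    have hstep : ∃ p : ℤ[X], (∀ j, p.coeff j ∈ Set.Ico 0 (b : ℤ)) ∧ aeval β A' = aeval β p := by
      rcases Nat.eq_zero_or_pos r with h0 | h0
      · by_cases hA0 : aeval β A' = 0
        · exact ⟨0, by simp [hb], by simp [hA0]⟩
        refine iht A' (by rw [← hs, heval, h0, add_zero]) hA0 fun hdvd => hn ?_
        rw [haeval, h0, Nat.cast_zero, zero_add, pow_succ']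
        exact mul_dvd_mul_left _ hdvd
      · exact ihs _ (by omega) A' rfl
    obtain ⟨p, hp, hpA⟩ := hstep
    refine ⟨X * p + C (r : ℤ), ?_, ?_⟩
    · rintro (_ | j)
      · have : r < b := Nat.mod_lt _ hb
        simp [this]
      · simpa using hp j
    · rw [haeval, hpA]
      simp [add_comm]

/-- Signs are removed by writing `-n` as `n * E(β)`. -/
theorem exists_nat_polynomial_aeval_eq {R : Type*} [CommRing R] {β : R} {E : ℕ[X]}
    (hE : aeval β E = -1) (p : ℤ[X]) : ∃ A : ℕ[X], aeval β A = aeval β p := by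
  induction p using Polynomial.induction_on with
  | C z =>
    obtain ⟨n, rfl | rfl⟩ := z.eq_nat_or_neg
    · exact ⟨C n, by simp⟩
    · exact ⟨C n * E, by simp [hE]⟩
  | add p q hp hq =>
    obtain ⟨A, hA⟩ := hp
    obtain ⟨B, hB⟩ := hq
    exact ⟨A + B, by simp [hA, hB]⟩
  | monomial n z h =>
    obtain ⟨A, hA⟩ := h
    exact ⟨A * X, by rw [map_mul, hA, pow_succ, ← mul_assoc, map_mul]; simp⟩

theorem exists_nat_polynomial_map_eq {p : ℤ[X]} (hp : ∀ j, 0 ≤ p.coeff j) :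
    ∃ q : ℕ[X], q.map (Nat.castRingHom ℤ) = p := by
  rw [← mem_lifts, lifts_iff_coeff_lifts]
  exact fun j => ⟨(p.coeff j).toNat, by simp [hp j]⟩

theorem aeval_map_natCast {R : Type*} [CommRing R] (β : R) (q : ℕ[X]) :
    aeval β (q.map (Nat.castRingHom ℤ)) = aeval β q :=
  aeval_map_algebraMap ℤ β q

/-- Kovács' criterion, in a presentation `R` of `ℤ[X] / (P)`: if `P` has decreasing coefficients and
constant term at least `2`, the class of `X` is the base of a number system. -/
theorem isNumberSystem_of_antitone_coeff {R : Type*} [CommRing R] [IsDomain R] [IsNoetherianRing R]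
    {P : ℤ[X]} (hanti : Antitone P.coeff) (h2 : 2 ≤ P.coeff 0) (φ : ℤ[X] →+* R)
    (hφ : Function.Surjective φ) (hker : ∀ f, φ f = 0 ↔ P ∣ f) :
    IsNumberSystem (φ X) (Set.Ico 0 (P.coeff 0)) := by
  set β := φ X with hβ
  have hφβ : ∀ f : ℤ[X], aeval β f = φ f := fun f => by
    have : (aeval β : ℤ[X] →ₐ[ℤ] R).toRingHom = φ := by ext <;> simp [hβ]
    exact congrArg (· f) (congrArg DFunLike.coe this)
  have hnonneg : ∀ j, 0 ≤ P.coeff j := fun j => by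
    rw [← coeff_eq_zero_of_natDegree_lt (show P.natDegree < j + P.natDegree + 1 by omega)]
    exact hanti (by omega)
  obtain ⟨b, hb⟩ := Int.eq_ofNat_of_zero_le (hnonneg 0)
  have hb2 : 2 ≤ b := by omega
  have hPβ : aeval β P = 0 := by rw [hφβ, hker]
  have hdivX : β * aeval β P.divX = -(b : R) := by
    have := hPβ
    nth_rw 1 [← X_mul_divX_add P] at this
    rw [hb] at this
    simp only [map_add, map_mul, aeval_X, eq_intCast, map_intCast] at this
    push_cast at this
    linear_combination this
  have hdvd : ∀ n : ℤ, β ∣ (n : R) → (b : ℤ) ∣ n := by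
    rintro n ⟨γ, hγ⟩
    obtain ⟨A, rfl⟩ := hφ γ
    have : φ (C n - X * A) = 0 := by
      rw [map_sub, map_mul, ← hβ, ← hγ]; simp
    obtain ⟨B, hB⟩ := (hker _).1 this
    have := congrArg (coeff · 0) hB
    simp only [coeff_sub, coeff_C_zero, mul_coeff_zero, coeff_X_zero, zero_mul, sub_zero] at this
    exact ⟨B.coeff 0, by rw [this, hb]⟩
  have hunit : ¬ IsUnit β := fun h => by
    have := hdvd 1 (by simpa using h.dvd)
    have := Int.le_of_dvd one_pos this
    omega
  have hβ0 : β ≠ 0 := fun h => by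
    obtain ⟨B, hB⟩ := (hker _).1 h
    have h0 := congrArg (coeff · 0) hB
    simp only [coeff_X_zero, mul_coeff_zero] at h0
    -- From `X = P * B`: the constant terms give `B.coeff 0 = 0`, then the linear terms give
    -- `P.coeff 0 ∣ 1`.
    have hB0 : B.coeff 0 = 0 := by
      rcases mul_eq_zero.1 h0.symm with h | h
      · omega
      · exact h
    have h1 := congrArg (coeff · 1) hB
    simp only [coeff_X_one, mul_coeff_one, hB0, mul_zero, add_zero] at h1
    have := Int.le_of_dvd one_pos ⟨_, h1⟩
    omega
  -- The coefficients `p_j - p_{j+1}` of `D` telescope to `p_0`.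
  obtain ⟨D, hD⟩ := exists_nat_polynomial_map_eq (p := P - P.divX) fun j => by
    rw [coeff_sub, coeff_divX]; exact sub_nonneg.2 (hanti (Nat.le_succ j))
  obtain ⟨E, hE⟩ := exists_nat_polynomial_map_eq (p := P - 1) fun j => by
    rcases j with _ | j
    · simp; omega
    · simpa [coeff_one] using hnonneg _
  have hDβ : β * aeval β D = b := by
    rw [← aeval_map_natCast, hD, map_sub, hPβ, zero_sub, mul_neg, hdivX, neg_neg]
  have hD1 : D.eval 1 = b := by
    have h1 : (D.map (Nat.castRingHom ℤ)).eval 1 = P.coeff 0 := by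
      rw [hD]
      nth_rw 1 [← X_mul_divX_add P]
      simp
    rw [eval_one_map, hb, eq_natCast] at h1
    exact Int.natCast_inj.1 h1
  have hEβ : aeval β E = -1 := by rw [← aeval_map_natCast, hE]; simp [hPβ]
  rw [hb]
  refine isNumberSystem_of_existsUnique_polynomial fun γ => ?_
  obtain ⟨g, rfl⟩ := hφ γ
  obtain ⟨A, hA⟩ := exists_nat_polynomial_aeval_eq hEβ g
  obtain ⟨p, hp, hpA⟩ := exists_digits_of_aeval_nat (by omega) hD1 hDβ
    (fun γ hγ => FiniteMultiplicity.of_not_isUnit hunit hγ) A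
  have hgp : φ g = aeval β p := by rw [← hpA, hA, hφβ]
  refine ⟨p, ⟨hp, hgp⟩, fun q ⟨hq, hgq⟩ => ?_⟩
  refine sub_eq_zero.1 (eq_zero_of_aeval_eq_zero_of_abs_coeff_lt hβ0 hdvd (fun j => ?_) ?_)
  · have h1 := hp j
    have h2 := hq j
    simp only [Set.mem_Ico] at h1 h2
    rw [coeff_sub, abs_lt]
    constructor <;> linarith
  · rw [map_sub, ← hgp, ← hgq, sub_self]

/-- Kovács' criterion: a monic prime polynomial with decreasing coefficients and constant term at
least `2` is the base polynomial of a canonical number system. -/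
theorem isCanonicalNumberSystem_of_antitone_coeff {P : ℤ[X]} (hmonic : P.Monic) (hprime : Prime P)
    (hanti : Antitone P.coeff) (h2 : 2 ≤ P.coeff 0) :
    IsCanonicalNumberSystem P (Set.Ico 0 |P.coeff 0|) := by
  have : IsDomain (AdjoinRoot P) := AdjoinRoot.isDomain_of_prime hprime
  have : IsNoetherianRing (AdjoinRoot P) :=
    isNoetherianRing_of_surjective _ _ (AdjoinRoot.mk P) AdjoinRoot.mk_surjective
  refine ⟨hmonic, rfl, ?_⟩
  rw [abs_of_nonneg (by omega), ← AdjoinRoot.mk_X]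
  exact isNumberSystem_of_antitone_coeff hanti h2 (AdjoinRoot.mk P) AdjoinRoot.mk_surjective
    fun f => AdjoinRoot.mk_eq_zero

/-! ### Decreasing Taylor coefficients -/

theorem natDegree_iterate_derivative_eq (f : ℂ[X]) (n : ℕ) :
    (derivative^[n] f).natDegree = f.natDegree - n := by
  induction n with
  | zero => rfl
  | succ n ih => rw [Function.iterate_succ_apply', natDegree_derivative, ih, Nat.sub_sub]

theorem eval_ne_zero_of_one_lt {f : ℂ[X]} (hroots : f.rootSet ℂ ⊆ Metric.closedBall 0 1)
    (hf : f ≠ 0) {x : ℝ} (hx : 1 < x) : f.eval (x : ℂ) ≠ 0 := fun h => by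
  have := hroots (mem_rootSet.2 ⟨hf, by simpa [coe_aeval_eq_eval] using h⟩)
  rw [mem_closedBall_zero_iff, Complex.norm_real, Real.norm_eq_abs,
    abs_of_pos (by linarith)] at this
  linarith

/-- Each root `z` contributes `1 / (x - z)`, of positive real part and of norm at most `1 / (x - 1)
≤ 1 / deg f`. -/
theorem logDeriv_bounds_of_roots_in_unit_disc {f : ℂ[X]}
    (hroots : f.rootSet ℂ ⊆ Metric.closedBall 0 1) (hf : 0 < f.natDegree) {x : ℝ}
    (hx : (f.natDegree : ℝ) + 1 ≤ x) :
    0 < (f.derivative.eval (x : ℂ) / f.eval (x : ℂ)).re ∧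
      (f.derivative.eval (x : ℂ) / f.eval (x : ℂ)).re ≤ 1 := by
  have hf0 : f ≠ 0 := by rintro rfl; simp at hf
  have hd : (0 : ℝ) < f.natDegree := by exact_mod_cast hf
  have hsplit := IsAlgClosed.splits f
  have hz : ∀ z ∈ f.roots, ‖z‖ ≤ 1 := fun z hz => by
    have := hroots (mem_rootSet.2 ⟨hf0, by simpa [coe_aeval_eq_eval] using (mem_roots'.1 hz).2⟩)
    simpa using this
  rw [hsplit.eval_derivative_div_eval_of_ne_zero (eval_ne_zero_of_one_lt hroots hf0 (by linarith)),
    show ∀ s : Multiset ℂ, s.sum.re = (s.map Complex.re).sum from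
      map_multiset_sum Complex.reAddGroupHom, Multiset.map_map]
  have hterm : ∀ z ∈ f.roots, 0 < (1 / ((x : ℂ) - z)).re ∧
      (1 / ((x : ℂ) - z)).re ≤ 1 / f.natDegree := fun z hzr => by
    have h1 := hz z hzr
    have h2 : z.re ≤ 1 := (Complex.re_le_norm z).trans h1
    have hre : 0 < ((x : ℂ) - z).re := by simp; linarith
    have h0 : (x : ℂ) - z ≠ 0 := fun h => by rw [h] at hre; simp at hre
    constructor
    · rw [one_div, Complex.inv_re]
      exact div_pos hre (Complex.normSq_pos.2 h0)
    · refine (Complex.re_le_norm _).trans ?_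
      rw [norm_div, norm_one]
      refine one_div_le_one_div_of_le hd ?_
      have := (Complex.re_le_norm ((x : ℂ) - z))
      simp at this
      linarith
  have hcard : f.roots.card = f.natDegree := hsplit.natDegree_eq_card_roots.symm
  constructor
  · refine Multiset.sum_induction_nonempty (fun r : ℝ => 0 < r) (fun _ _ => add_pos) ?_ ?_
    · rw [Ne, Multiset.empty_eq_zero, Multiset.map_eq_zero, ← Multiset.card_eq_zero]
      omega
    · rintro _ hr
      obtain ⟨z, hzr, rfl⟩ := Multiset.mem_map.1 hr
      exact (hterm z hzr).1
  · refine (Multiset.sum_le_card_nsmul _ (1 / (f.natDegree : ℝ)) ?_).trans ?_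
    · rintro _ hr
      obtain ⟨z, hzr, rfl⟩ := Multiset.mem_map.1 hr
      exact (hterm z hzr).2
    · rw [Multiset.card_map, hcard, nsmul_eq_mul, mul_one_div_cancel hd.ne']

theorem rootSet_iterate_derivative_subset {f : ℂ[X]}
    (hroots : f.rootSet ℂ ⊆ Metric.closedBall 0 1) (n : ℕ) :
    (derivative^[n] f).rootSet ℂ ⊆ Metric.closedBall 0 1 := by
  induction n with
  | zero => exact hroots
  | succ n ih =>
    rw [Function.iterate_succ_apply']
    by_cases h : 0 < (derivative^[n] f).degree
    · exact (rootSet_derivative_subset_convexHull_rootSet h).trans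
        (convexHull_min ih (convex_closedBall 0 1))
    · rw [eq_C_of_degree_le_zero (not_lt.1 h)]
      simp

/-- If all roots of a monic integer polynomial lie in the unit disc and `m` exceeds its degree,
then the Taylor coefficients at `m` are decreasing. -/
theorem antitone_coeff_taylor {f : ℤ[X]} (hf : f.Monic)
    (hroots : (f.map (Int.castRingHom ℂ)).rootSet ℂ ⊆ Metric.closedBall 0 1) {m : ℤ}
    (hm : (f.natDegree : ℤ) + 1 ≤ m) : Antitone (taylor m f).coeff := by
  set F := f.map (Int.castRingHom ℂ) with hF
  have hFd : F.natDegree = f.natDegree := natDegree_map_eq_of_injective Int.cast_injective f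
  have heval : ∀ n, (derivative^[n] F).eval (((m : ℝ) : ℂ)) =
      ((n.factorial * (taylor m f).coeff n : ℤ) : ℂ) := fun n => by
    rw [taylor_coeff, ← nsmul_eq_mul, ← eval_smul, ← LinearMap.smul_apply,
      factorial_smul_hasseDeriv, hF, iterate_derivative_map]
    simp
  have hstep : ∀ n, n < f.natDegree → 0 < (taylor m f).coeff (n + 1) →
      (taylor m f).coeff (n + 1) ≤ (taylor m f).coeff n := fun n hn hpos => by
    have hdeg : (derivative^[n] F).natDegree = f.natDegree - n := by
      rw [natDegree_iterate_derivative_eq, hFd]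
    have hm' : (f.natDegree : ℝ) + 1 ≤ m := by exact_mod_cast hm
    obtain ⟨h1, h2⟩ := logDeriv_bounds_of_roots_in_unit_disc (x := (m : ℝ))
      (rootSet_iterate_derivative_subset hroots n) (by omega)
      (le_trans (by gcongr; omega) hm')
    rw [← Function.iterate_succ_apply' derivative, heval, heval, ← Complex.ofReal_intCast,
      ← Complex.ofReal_intCast, ← Complex.ofReal_div, Complex.ofReal_re, Nat.factorial_succ] at h1 h2
    push_cast at h1 h2
    have hfac : (0 : ℝ) < n.factorial := by exact_mod_cast n.factorial_pos
    have hpos' : (0 : ℝ) < (taylor m f).coeff (n + 1) := by exact_mod_cast hpos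
    -- The positive quotient transfers the sign of `p_{n+1}` to `p_n`; positivity thus descends from
    -- the leading coefficient `1`.
    have hden : 0 < (n.factorial : ℝ) * ((taylor m f).coeff n : ℝ) :=
      (div_pos_iff_of_pos_left (by positivity)).1 h1
    rw [div_le_one hden, mul_comm ((n : ℝ) + 1), mul_assoc, mul_le_mul_iff_right₀ hfac] at h2
    have : ((taylor m f).coeff (n + 1) : ℝ) ≤ (taylor m f).coeff n := by
      refine le_trans ?_ h2
      nlinarith [n.cast_nonneg (α := ℝ)]
    exact_mod_cast this
  have hpos : ∀ n, n ≤ f.natDegree → 0 < (taylor m f).coeff n := fun n hn => by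
    induction hn using Nat.decreasingInduction with
    | self => rw [coeff_taylor_natDegree, hf.leadingCoeff]; exact one_pos
    | of_succ n hn ih => exact ih.trans_le (hstep n hn ih)
  refine antitone_nat_of_succ_le fun n => ?_
  rcases lt_or_ge n f.natDegree with h | h
  · exact hstep n h (hpos _ h)
  · rw [coeff_eq_zero_of_natDegree_lt (n := n + 1) (by rw [natDegree_taylor]; omega)]
    rcases h.eq_or_lt with h | h
    · exact (hpos n h.ge).le
    · rw [coeff_eq_zero_of_natDegree_lt (by rwa [natDegree_taylor])]

theorem rootSet_cyclotomic_subset_closedBall {k : ℕ} (hk : k ≠ 0) :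
    ((cyclotomic k ℤ).map (Int.castRingHom ℂ)).rootSet ℂ ⊆ Metric.closedBall 0 1 := fun z hz => by
  have : NeZero (k : ℂ) := ⟨by exact_mod_cast hk⟩
  have hz := (mem_rootSet.1 hz).2
  rw [map_cyclotomic, coe_aeval_eq_eval, ← IsRoot.def, isRoot_cyclotomic_iff] at hz
  simpa using (hz.norm'_eq_one hk).le

/-! ### Translation by `m` and transfer to `ℤ[ζ]` -/

theorem monic_taylor {R : Type*} [CommRing R] {f : R[X]} (hf : f.Monic) (r : R) :
    (taylor r f).Monic := by
  rw [Monic, leadingCoeff_taylor, hf.leadingCoeff]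

theorem minpoly_int_sub_intCast {S : Type*} [CommRing S] [IsDomain S] [Module.IsTorsionFree ℤ S]
    {x : S} (hx : IsIntegral ℤ x) (m : ℤ) : minpoly ℤ (x - m) = taylor m (minpoly ℤ x) := by
  refine (IsIntegrallyClosed.minpoly.unique (monic_taylor (minpoly.monic hx) m) ?_ ?_).symm
  · rw [taylor_apply, aeval_comp]; simp
  · intro Q hQ hQx
    rw [degree_taylor, ← degree_taylor Q (-m)]
    refine minpoly.min ℤ x (monic_taylor hQ _) ?_
    rw [taylor_apply, aeval_comp]
    simpa [sub_eq_add_neg] using hQx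

theorem adjoin_int_sub_intCast {S : Type*} [CommRing S] (x : S) (m : ℤ) :
    Algebra.adjoin ℤ {x - (m : S)} = Algebra.adjoin ℤ {x} := by
  have hm : ∀ A : Subalgebra ℤ S, (m : S) ∈ A := fun A => by
    simp
  refine le_antisymm (Algebra.adjoin_le ?_) (Algebra.adjoin_le ?_) <;>
    rw [Set.singleton_subset_iff, SetLike.mem_coe]
  · exact sub_mem (Algebra.self_mem_adjoin_singleton ℤ x) (hm _)
  · simpa using add_mem (Algebra.self_mem_adjoin_singleton ℤ (x - (m : S))) (hm _)

/-- A canonical number system for the minimal polynomial of `β` gives one in `ℤ[β]`. -/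
theorem IsCanonicalNumberSystem.existsUnique_repr {β : ℂ} {N : Set ℤ} (hβ : IsIntegral ℤ β)
    (h : IsCanonicalNumberSystem (minpoly ℤ β) N) {γ : ℂ} (hγ : γ ∈ Algebra.adjoin ℤ {β}) :
    ∃! a : ℕ →₀ ℤ, (∀ j, a j ∈ N) ∧ γ = a.sum fun j d => (d : ℂ) * β ^ j := by
  let ψ : AdjoinRoot (minpoly ℤ β) →+* ℂ :=
    (Algebra.adjoin ℤ {β}).val.toRingHom.comp (minpoly.equivAdjoin hβ : _ ≃+* _).toRingHom
  have hψ : Function.Injective ψ :=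
    Subtype.val_injective.comp (minpoly.equivAdjoin hβ).injective
  have hroot : ψ (AdjoinRoot.root (minpoly ℤ β)) = β := by
    simp [ψ, AdjoinRoot.Minpoly.toAdjoin]
  have hsum : ∀ a : ℕ →₀ ℤ, ψ (a.sum fun j d => (d : AdjoinRoot (minpoly ℤ β)) *
      AdjoinRoot.root (minpoly ℤ β) ^ j) = a.sum fun j d => (d : ℂ) * β ^ j := fun a => by
    simp [Finsupp.sum, hroot]
  obtain ⟨δ, hδ⟩ := (minpoly.equivAdjoin hβ).surjective ⟨γ, hγ⟩
  have hδγ : ψ δ = γ := congrArg Subtype.val hδ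
  have hiff : ∀ a : ℕ →₀ ℤ, (γ = a.sum fun j d => (d : ℂ) * β ^ j) ↔
      δ = a.sum fun j d => (d : AdjoinRoot (minpoly ℤ β)) *
        AdjoinRoot.root (minpoly ℤ β) ^ j := fun a => by
    rw [← hsum, ← hδγ, hψ.eq_iff]
  simpa only [hiff] using h.isNumberSystem δ

theorem two_le_eval_cyclotomic {k m : ℕ} (hk : 2 < k) (hm : 2 ≤ m) :
    2 ≤ (cyclotomic k ℤ).eval (m : ℤ) := by
  have h1 : (1 : ℝ) < m := by exact_mod_cast (by omega : 1 < m)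
  -- `Φ_k(m) > (m - 1) ^ φ(k) ≥ 1`, and the value is an integer.
  have h2 := sub_one_pow_totient_lt_cyclotomic_eval (n := k) (by omega) h1
  have h3 : (1 : ℝ) ≤ ((m : ℝ) - 1) ^ k.totient :=
    one_le_pow₀ (by have : (2 : ℝ) ≤ m := by exact_mod_cast hm
                    linarith)
  have h4 : (cyclotomic k ℝ).eval (m : ℝ) = ((cyclotomic k ℤ).eval (m : ℤ) : ℤ) := by
    rw [← map_cyclotomic_int]
    simpa using eval_intCast_map (Int.castRingHom ℝ) (cyclotomic k ℤ) (m : ℤ)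
  have h5 : (1 : ℝ) < ((cyclotomic k ℤ).eval (m : ℤ) : ℤ) := by rw [← h4]; linarith
  exact_mod_cast h5

theorem theorem1 (k m : ℕ) (hk : 2 < k) (hm : Nat.totient k + 1 ≤ m)
    (ζ : ℂ) (hζ : IsPrimitiveRoot ζ k) :
    IsCanonicalNumberSystemIn (-(m : ℂ) + ζ)
      (Set.Ico 0 |(cyclotomic k ℤ).eval (m : ℤ)|) (Algebra.adjoin ℤ {ζ}) := by
  have hk0 : 0 < k := by omega
  have hint : IsIntegral ℤ ζ := hζ.isIntegral hk0
  have hβ : -(m : ℂ) + ζ = ζ - ((m : ℤ) : ℂ) := by push_cast; ring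
  have hmin : minpoly ℤ (-(m : ℂ) + ζ) = taylor (m : ℤ) (cyclotomic k ℤ) := by
    rw [hβ, minpoly_int_sub_intCast hint, cyclotomic_eq_minpoly hζ hk0]
  have hβint : IsIntegral ℤ (-(m : ℂ) + ζ) := by
    rw [hβ]
    exact hint.sub (isIntegral_algebraMap (x := (m : ℤ)))
  have hadj : Algebra.adjoin ℤ {-(m : ℂ) + ζ} = Algebra.adjoin ℤ {ζ} := by
    rw [hβ, adjoin_int_sub_intCast]
  have htot : 0 < k.totient := Nat.totient_pos.2 hk0
  have hcns : IsCanonicalNumberSystem (minpoly ℤ (-(m : ℂ) + ζ))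
      (Set.Ico 0 |(cyclotomic k ℤ).eval (m : ℤ)|) := by
    have hprime := minpoly.prime_of_isIntegrallyClosed hβint
    rw [hmin] at hprime ⊢
    rw [← taylor_coeff_zero]
    refine isCanonicalNumberSystem_of_antitone_coeff (monic_taylor (cyclotomic.monic k ℤ) _) hprime
      (antitone_coeff_taylor (cyclotomic.monic k ℤ)
        (rootSet_cyclotomic_subset_closedBall hk0.ne') ?_) ?_
    · rw [natDegree_cyclotomic]; exact_mod_cast hm
    · rw [taylor_coeff_zero]; exact two_le_eval_cyclotomic hk (by omega)
  exact ⟨hadj, hcns, fun γ hγ => hcns.existsUnique_repr hβint (hadj ▸ hγ)⟩
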